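/- Let $p$ be a prime, $G$ a finite group, $P$ a Sylow $p$-subgroup of $G$, $M$ a trivial $G$-module (an abelian group on which $G$ acts trivially) and $n\ge 0$. For a group $H$ and an $H$-module $M$, let $$\mathrm{Sha}^n(H,M)=\bigcap_{A\le H,\ A\text{ abelian}}\ker\bigl(\operatorname{res}^H_A\colon H^n(H,M)\to H^n(A,M)\bigr).$$ A characteristic $p$-functor $W$ assigns to every finite $p$-group $Q$ a characteristic subgroup $W(Q)$ of $Q$, in such a way that every isomorphism $Q\to R$ of finite $p$-groups maps $W(Q)$ onto $W(R)$ (it is not required that $W(Q)\neq 1$ when $Q\ne 1$). It strongly controls fusion in $G$ if, for every Sylow $p$-subgroup $Q$ of $G$, every subset $A\subseteq Q$ and every $g\in G$ with $g^{-1}Ag\subseteq Q$, there are $c\in C_G(A)$ and $h\in N_G(W(Q))$ with $g=ch$. Let $W$ be a characteristic $p$-functor that strongly controls fusion in $G$. Then the Sylow $p$-subgroups (that is, the maximal $p$-subgroups) of $\mathrm{Sha}^n(G,M)$ and $\mathrm{Sha}^n(N_G(W(P)),M)$ are isomorphic. -/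

import Mathlib

universe u

/-- `Ш^n(G, M)`: the intersection, over all abelian subgroups `A` of `G`, of the kernels of the
restriction maps `H^n(G, M) → H^n(A, M)`.  For `k = ℤ` the objects of `Rep k G` are the
`G`-modules. -/
noncomputable def Sha {k G : Type u} [CommRing k] [Group G] (M : Rep.{u} k G) (n : ℕ) :
    Submodule k (groupCohomology M n) :=
  ⨅ (A : Subgroup G) (_ : ∀ x ∈ A, ∀ y ∈ A, x * y = y * x),
    LinearMap.ker
      (groupCohomology.map A.subtype (CategoryTheory.CategoryStruct.id (Rep.res A.subtype M)) n).hom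

/-- A characteristic `p`-functor: an assignment to every finite `p`-group `P` of a subgroup `W(P)`
of `P` such that every isomorphism `P ≃ Q` of finite `p`-groups carries `W(P)` onto `W(Q)`.
Taking `P = Q` shows that `W(P)` is a characteristic subgroup of `P`
(`CharacteristicPFunctor.obj_characteristic`).  It is not required that `W(P) ≠ 1` for `P ≠ 1`. -/
structure CharacteristicPFunctor (p : ℕ) where
  obj : ∀ (P : Type u) [Group P] [Finite P], IsPGroup p P → Subgroup P
  map_obj : ∀ (P Q : Type u) [Group P] [Finite P] [Group Q] [Finite Q]
    (hP : IsPGroup p P) (hQ : IsPGroup p Q) (e : P ≃* Q),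
    (obj P hP).map e.toMonoidHom = obj Q hQ

theorem CharacteristicPFunctor.obj_characteristic {p : ℕ} (W : CharacteristicPFunctor.{u} p)
    (P : Type u) [Group P] [Finite P] (hP : IsPGroup p P) : (W.obj P hP).Characteristic :=
  Subgroup.characteristic_iff_map_eq.2 fun e => W.map_obj P P hP hP e

/-- The subgroup `W(P)`, for a Sylow `p`-subgroup `P` of `G`, regarded as a subgroup of `G`. -/
def CharacteristicPFunctor.onSylow {p : ℕ} (W : CharacteristicPFunctor.{u} p)
    {G : Type u} [Group G] [Finite G] (P : Sylow p G) : Subgroup G :=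
  (W.obj (P : Subgroup G) P.isPGroup').map (P : Subgroup G).subtype

/-- The subgroup `H` strongly controls fusion in `P` with respect to `G`: whenever `A ⊆ P` and
`g ∈ G` satisfy `g⁻¹ A g ⊆ P`, one has `g = c h` with `c ∈ C_G(A)` and `h ∈ H`. -/
def StronglyControlsFusionIn {G : Type u} [Group G] (H P : Subgroup G) : Prop :=
  ∀ (A : Set G) (g : G), A ⊆ P → (∀ a ∈ A, g⁻¹ * a * g ∈ P) →
    ∃ c ∈ Subgroup.centralizer A, ∃ h ∈ H, g = c * h

/-- `W` strongly controls fusion in `G`: for every Sylow `p`-subgroup `P` of `G`, the normalizer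
`N_G(W(P))` strongly controls fusion in `P` with respect to `G`. -/
def CharacteristicPFunctor.StronglyControlsFusion {p : ℕ} (W : CharacteristicPFunctor.{u} p)
    (G : Type u) [Group G] [Finite G] : Prop :=
  ∀ P : Sylow p G,
    StronglyControlsFusionIn (Subgroup.normalizer (W.onSylow P : Set G)) (P : Subgroup G)

/-! Put `N = N_G(W(P))`, which contains `P`. Restriction from `G` to `N` is shown to be bijective on
the `p`-primary parts of `Sha`. Since the coefficients are trivial, the cohomology of every `H ≤ G`
is computed by the `H`-invariant functions on powers of `G`. Restriction is then inclusion of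
invariants, and `G` acts on all cochains by translation. Injectivity: `[N : P]` kills the kernel of
restriction to `P`, and `[G : N]` is prime to `p`. Surjectivity: let `f` be an `N`-cocycle and `w =
∑ g • f` over `gP ∈ G/P`. The stabilizer of `gP` in `P` is `A = P ∩ gPg⁻¹`. Strong control gives `g
= ch` with `c` centralizing `A` and `h ∈ N`, so `g • f = c • f`, which is cohomologous to `f` over
`A`. Choosing the primitives `P`-equivariantly and adding them shows `w ~ [G : P] f` over `P`
(`sum_smul_sub_index_smul_mem_coboundaries`). A Bézout multiple `y` of `w` then restricts to `f`. To
see that `y` dies on an abelian subgroup, pass to its Sylow `p`-subgroup and conjugate that into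
`P`, where `y ~ f` (`exists_cocycle_extension`). -/

section EquivariantChoice

/-! ### Equivariant selections -/

variable {P X B : Type*} [Group P] [MulAction P X] [MulAction P B]

/-- A `P`-stable relation between `P`-sets has an equivariant selection as soon as every point `x`
is related to a point fixed by the stabilizer of `x`. -/
theorem exists_equivariant_choice (R : X → B → Prop)
    (hR : ∀ (p : P) x b, R x b → R (p • x) (p • b))
    (h : ∀ x, ∃ b, R x b ∧ ∀ p : P, p • x = x → p • b = b) :
    ∃ u : X → B, (∀ x, R x (u x)) ∧ ∀ (p : P) x, u (p • x) = p • u x := by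
  choose b hb hfix using h
  let r : X → X := fun x => (Quotient.mk (MulAction.orbitRel P X) x).out
  have hr : ∀ x, ∃ p : P, p • r x = x := fun x =>
    MulAction.orbitRel_apply.1
      ((MulAction.orbitRel P X).symm (Quotient.mk_out (s := MulAction.orbitRel P X) x))
  have hrp : ∀ (p : P) x, r (p • x) = r x := fun p x => by
    have : Quotient.mk (MulAction.orbitRel P X) (p • x) = Quotient.mk _ x :=
      Quotient.sound (MulAction.orbitRel_apply.2 ⟨p, rfl⟩)
    simp only [r, this]
  choose t ht using hr
  refine ⟨fun x => t x • b (r x), fun x => ?_, fun p x => ?_⟩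
  · have := hR (t x) _ _ (hb (r x))
    rwa [ht] at this
  -- The two ways of transporting the representative `r x` to `p • x` differ by its stabilizer,
  -- which fixes `b (r x)`.
  · have hstab : ((p * t x)⁻¹ * t (p • x)) • r x = r x := by
      have h1 := ht (p • x)
      rw [hrp] at h1
      rw [mul_smul, h1, inv_smul_eq_iff, mul_smul, ht]
    have h2 := hfix _ _ hstab
    rw [mul_smul, inv_smul_eq_iff, mul_smul] at h2
    simp only [hrp]
    exact h2

end EquivariantChoice

/-! ### The augmented homogeneous complex and the prism homotopy -/

/-- Functions of `n` variables in `G` with values in `V`; in degree `n + 1` these are the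
homogeneous `n`-cochains. -/
abbrev HomogeneousCochain (G V : Type*) (n : ℕ) := (Fin n → G) → V

namespace HomogeneousCochain

variable {G V : Type*} [AddCommGroup V] {n : ℕ}

/-- The homogeneous coboundary. -/
def coboundary : HomogeneousCochain G V n →+ HomogeneousCochain G V (n + 1) where
  toFun f := fun x => ∑ i : Fin (n + 1), (-1 : ℤ) ^ (i : ℕ) • f (x ∘ i.succAbove)
  map_zero' := by
    funext x
    exact Finset.sum_eq_zero fun i _ => smul_zero ((-1 : ℤ) ^ (i : ℕ))
  map_add' f g := by
    funext x
    simp [Finset.sum_add_distrib, smul_add]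

theorem coboundary_apply (f : HomogeneousCochain G V n) (x : Fin (n + 1) → G) :
    coboundary f x = ∑ i : Fin (n + 1), (-1 : ℤ) ^ (i : ℕ) • f (x ∘ i.succAbove) := rfl

/-- Fixing the first variable. -/
def slice (a : G) : HomogeneousCochain G V (n + 1) →+ HomogeneousCochain G V n where
  toFun f := fun x => f (Fin.cons a x : Fin (n + 1) → G)
  map_zero' := rfl
  map_add' _ _ := rfl

theorem slice_apply (a : G) (f : HomogeneousCochain G V (n + 1)) (x : Fin n → G) :
    slice a f x = f (Fin.cons a x : Fin (n + 1) → G) := rfl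

theorem coboundary_zero_apply (f : HomogeneousCochain G V 0) (x : Fin 1 → G) :
    coboundary f x = f ![] := by
  rw [coboundary_apply, Fin.sum_univ_one]
  simp only [Fin.val_zero, pow_zero, one_smul]
  congr 1
  exact Subsingleton.elim _ _

/-- Omitting `a` gives `f`; every other face keeps `a` and has its sign shifted by one. This drives
the inductions on the degree below. -/
theorem slice_coboundary (a : G) (f : HomogeneousCochain G V (n + 1)) :
    slice a (coboundary f) = f - coboundary (slice a f) := by
  funext x
  rw [slice_apply, coboundary_apply, Fin.sum_univ_succ, Pi.sub_apply, coboundary_apply,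
    sub_eq_add_neg, ← Finset.sum_neg_distrib]
  congr 1
  · simp only [Fin.val_zero, pow_zero, one_smul]
    congr 1
  · refine Finset.sum_congr rfl fun i _ => ?_
    rw [slice_apply, Fin.val_succ, pow_succ, mul_neg_one, neg_smul]
    congr 3
    funext j
    refine Fin.cases ?_ (fun j => ?_) j <;> simp

theorem coboundary_cons (a : G) (f : HomogeneousCochain G V (n + 1)) (x : Fin (n + 1) → G) :
    coboundary f (Fin.cons a x : Fin (n + 2) → G) = f x - coboundary (slice a f) x :=
  congr_fun (slice_coboundary a f) x

theorem coboundary_coboundary (f : HomogeneousCochain G V n) : coboundary (coboundary f) = 0 := by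
  induction n with
  | zero =>
    funext x
    rw [← Fin.cons_self_tail x, coboundary_cons, coboundary_zero_apply, coboundary_zero_apply]
    rw [slice_apply, coboundary_zero_apply]
    simp
  | succ n ih =>
    funext x
    rw [← Fin.cons_self_tail x, coboundary_cons, slice_coboundary, map_sub, ih]
    simp

/-- Pulling back along a map of the variables. -/
def comap (α : G → G) : HomogeneousCochain G V n →+ HomogeneousCochain G V n where
  toFun f := fun x => f (α ∘ x)
  map_zero' := rfl
  map_add' _ _ := rfl

theorem comap_apply (α : G → G) (f : HomogeneousCochain G V n) (x : Fin n → G) :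
    comap α f x = f (α ∘ x) := rfl

theorem coboundary_comap (α : G → G) (f : HomogeneousCochain G V n) :
    coboundary (comap α f) = comap α (coboundary f) := rfl

theorem comp_cons (α : G → G) (a : G) (x : Fin n → G) :
    α ∘ (Fin.cons a x : Fin (n + 1) → G) = Fin.cons (α a) (α ∘ x) := by
  funext j
  refine Fin.cases ?_ (fun j => ?_) j <;> simp

theorem comap_cons (α : G → G) (f : HomogeneousCochain G V (n + 1)) (a : G) (x : Fin n → G) :
    comap α f (Fin.cons a x : Fin (n + 1) → G) = comap α (slice (α a) f) x := by
  rw [comap_apply, comap_apply, slice_apply, comp_cons]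

theorem slice_comap (α : G → G) (a : G) (f : HomogeneousCochain G V (n + 1)) :
    slice a (comap α f) = comap α (slice (α a) f) := by
  funext x
  rw [slice_apply, comap_apply, comap_apply, slice_apply, comp_cons]

/-- The prism operator, the homotopy between the pullbacks along two maps. -/
def prism (α β : G → G) : ∀ n, HomogeneousCochain G V (n + 1) → HomogeneousCochain G V n
  -- Unfolded, this is `∑ (-1)^i f(αx₀, …, αxᵢ, βxᵢ, …, βxₙ₋₁)`, an empty sum in lowest degree.
  | 0, _ => fun _ => 0
  | n + 1, f => fun x =>
      comap β (slice (β (x 0)) (slice (α (x 0)) f)) (Fin.tail x)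
        - prism α β n (slice (α (x 0)) f) (Fin.tail x)

theorem prism_zero_apply (α β : G → G) (f : HomogeneousCochain G V 1) (x : Fin 0 → G) :
    prism α β 0 f x = 0 := rfl

theorem slice_prism (α β : G → G) (f : HomogeneousCochain G V (n + 2)) (a : G) :
    slice a (prism α β (n + 1) f) =
      comap β (slice (β a) (slice (α a) f)) - prism α β n (slice (α a) f) := rfl

theorem prism_cons (α β : G → G) (f : HomogeneousCochain G V (n + 2)) (a : G) (x : Fin n → G) :
    prism α β (n + 1) f (Fin.cons a x : Fin (n + 1) → G) =
      comap β (slice (β a) (slice (α a) f)) x - prism α β n (slice (α a) f) x := rfl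

theorem prism_sub (α β : G → G) (f g : HomogeneousCochain G V (n + 1)) :
    prism α β n (f - g) = prism α β n f - prism α β n g := by
  induction n with
  | zero => funext x; simp [prism_zero_apply]
  | succ n ih =>
    funext x
    rw [← Fin.cons_self_tail x, Pi.sub_apply, prism_cons, prism_cons, prism_cons]
    simp only [map_sub, ih, Pi.sub_apply]
    abel

theorem coboundary_prism (α β : G → G) (f : HomogeneousCochain G V (n + 1)) :
    coboundary (prism α β n f) + prism α β (n + 1) (coboundary f) = comap β f - comap α f := by
  induction n with
  | zero =>
    funext x
    obtain ⟨a, x, rfl⟩ : ∃ a y, x = Fin.cons a y := ⟨x 0, Fin.tail x, (Fin.cons_self_tail x).symm⟩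
    rw [Pi.add_apply, prism_cons, coboundary_zero_apply, slice_coboundary,
      prism_zero_apply, prism_zero_apply, map_sub, map_sub, Pi.sub_apply, Pi.sub_apply]
    rw [comap_cons, comap_cons]
    simp only [comap_apply, slice_apply, coboundary_zero_apply,
      Subsingleton.elim _ (![] : Fin 0 → G)]
    simp
  | succ n ih =>
    funext x
    obtain ⟨a, x, rfl⟩ : ∃ a y, x = Fin.cons a y := ⟨x 0, Fin.tail x, (Fin.cons_self_tail x).symm⟩
    have h : coboundary (prism α β n (slice (α a) f)) x +
        prism α β (n + 1) (coboundary (slice (α a) f)) x =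
        comap β (slice (α a) f) x - comap α (slice (α a) f) x :=
      congr_fun (ih (slice (α a) f)) x
    rw [Pi.add_apply, coboundary_cons, prism_cons, slice_prism, slice_coboundary, prism_sub]
    simp only [map_sub, slice_coboundary, Pi.sub_apply, coboundary_comap, comap_cons]
    rw [eq_sub_iff_add_eq] at h
    rw [← h]
    abel

/-! ### Translation action, invariant cocycles and coboundaries -/

section Action

variable [Group G]

scoped instance : DistribMulAction G (HomogeneousCochain G V n) where
  smul g := comap (g⁻¹ * ·)
  one_smul f := by funext x; change f _ = f _; congr 1; funext i; simp
  mul_smul g h f := by funext x; change f _ = f _; congr 1; funext i; simp [mul_assoc]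
  smul_zero g := map_zero (comap (g⁻¹ * ·))
  smul_add g := map_add (comap (g⁻¹ * ·))

theorem smul_apply (g : G) (f : HomogeneousCochain G V n) (x : Fin n → G) :
    (g • f) x = f (fun i => g⁻¹ * x i) := rfl

theorem coboundary_smul (g : G) (f : HomogeneousCochain G V n) :
    coboundary (g • f) = g • coboundary f := rfl

/-- Cochains invariant under a subgroup. -/
def invariants (V : Type*) [AddCommGroup V] (H : Subgroup G) (n : ℕ) :
    AddSubgroup (HomogeneousCochain G V n) where
  carrier := {f | ∀ h ∈ H, h • f = f}
  zero_mem' h _ := smul_zero h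
  add_mem' hf hg h hh := by rw [smul_add, hf h hh, hg h hh]
  neg_mem' hf h hh := by rw [smul_neg, hf h hh]

theorem invariants_apply {H : Subgroup G} {f : HomogeneousCochain G V n}
    (hf : f ∈ invariants V H n) {h : G} (hh : h ∈ H) (x : Fin n → G) :
    f (fun i => h * x i) = f x := by
  conv_rhs => rw [← hf h⁻¹ (H.inv_mem hh)]
  rw [smul_apply, inv_inv]

theorem invariants_anti {H K : Subgroup G} (hHK : H ≤ K) : invariants V K n ≤ invariants V H n :=
  fun _ hf h hh => hf h (hHK hh)

/-- Invariant homogeneous `n`-cocycles. -/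
def cocycles (V : Type*) [AddCommGroup V] (H : Subgroup G) (n : ℕ) :
    AddSubgroup (HomogeneousCochain G V (n + 1)) :=
  invariants V H (n + 1) ⊓ coboundary.ker

/-- Coboundaries of invariant cochains. -/
def coboundaries (V : Type*) [AddCommGroup V] (H : Subgroup G) (n : ℕ) :
    AddSubgroup (HomogeneousCochain G V (n + 1)) :=
  (invariants V H n).map coboundary

theorem cocycles_anti {H K : Subgroup G} (hHK : H ≤ K) : cocycles V K n ≤ cocycles V H n :=
  fun _ hf => ⟨invariants_anti hHK hf.1, hf.2⟩

theorem coboundaries_anti {H K : Subgroup G} (hHK : H ≤ K) :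
    coboundaries V K n ≤ coboundaries V H n :=
  AddSubgroup.map_mono (invariants_anti hHK)

theorem coboundaries_le_cocycles (H : Subgroup G) : coboundaries V H n ≤ cocycles V H n := by
  rintro _ ⟨u, hu, rfl⟩
  exact ⟨fun h hh => by rw [← coboundary_smul, hu h hh], coboundary_coboundary u⟩

theorem smul_mem_coboundaries {H : Subgroup G} {f : HomogeneousCochain G V (n + 1)} (g : G)
    {K : Subgroup G} (hK : ∀ x ∈ K, g⁻¹ * x * g ∈ H) (hf : f ∈ coboundaries V H n) :
    g • f ∈ coboundaries V K n := by
  obtain ⟨u, hu, rfl⟩ := hf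
  refine ⟨g • u, fun x hx => ?_, coboundary_smul g u⟩
  conv_rhs => rw [← hu _ (hK x hx)]
  simp only [smul_smul]
  congr 1
  group

theorem prism_smul {α β : G → G} {h : G} (hα : ∀ x, α (h * x) = h * α x)
    (hβ : ∀ x, β (h * x) = h * β x) (f : HomogeneousCochain G V (n + 1)) (x : Fin n → G) :
    prism α β n f (fun i => h * x i) = prism α β n (comap (h * ·) f) x := by
  induction n with
  | zero => rfl
  | succ n ih =>
    obtain ⟨a, x, rfl⟩ : ∃ a y, x = Fin.cons a y := ⟨x 0, Fin.tail x, (Fin.cons_self_tail x).symm⟩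
    have hc : (fun i => h * (Fin.cons a x : Fin (n + 1) → G) i) =
      Fin.cons (h * a) (fun i => h * x i) := comp_cons (h * ·) a x
    rw [hc, prism_cons, prism_cons, ih, hα, hβ, slice_comap, slice_comap]
    congr 1
    rw [comap_apply, comap_apply, comap_apply]
    have : (β ∘ fun i => h * x i) = (h * ·) ∘ β ∘ x := funext fun i => hβ (x i)
    rw [this]

theorem prism_mem_invariants {H : Subgroup G} {α β : G → G}
    (hα : ∀ h ∈ H, ∀ x, α (h * x) = h * α x) (hβ : ∀ h ∈ H, ∀ x, β (h * x) = h * β x)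
    {f : HomogeneousCochain G V (n + 1)} (hf : f ∈ invariants V H (n + 1)) :
    prism α β n f ∈ invariants V H n := by
  intro h hh
  funext x
  rw [smul_apply, prism_smul (hα _ (H.inv_mem hh)) (hβ _ (H.inv_mem hh))]
  congr 2
  exact hf h hh

/-- Equivariant maps of the variables induce the same map on classes. -/
theorem comap_sub_comap_mem_coboundaries {H : Subgroup G} {α β : G → G}
    (hα : ∀ h ∈ H, ∀ x, α (h * x) = h * α x) (hβ : ∀ h ∈ H, ∀ x, β (h * x) = h * β x)
    {f : HomogeneousCochain G V (n + 1)} (hf : f ∈ cocycles V H n) :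
    comap β f - comap α f ∈ coboundaries V H n := by
  refine ⟨prism α β n f, prism_mem_invariants hα hβ hf.1, ?_⟩
  have h0 : prism α β (n + 1) (0 : HomogeneousCochain G V (n + 2)) = 0 := by
    have := prism_sub α β (0 : HomogeneousCochain G V (n + 2)) 0
    rwa [sub_zero, sub_self] at this
  rw [← coboundary_prism, hf.2, h0, add_zero]

end Action

end HomogeneousCochain

/-! ### Sums over coset representatives -/

section Trace

variable {K B : Type*} [Group K] [AddCommGroup B] [DistribMulAction K B] {H : Subgroup K} {u : B}

theorem out_smul_eq (hu : ∀ h ∈ H, h • u = u) (k : K) : (k : K ⧸ H).out • u = k • u := by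
  obtain ⟨h, hh⟩ := QuotientGroup.mk_out_eq_mul H k
  rw [hh, mul_smul, hu _ h.2]

theorem smul_out_smul (hu : ∀ h ∈ H, h • u = u) (k : K) (c : K ⧸ H) :
    k • c.out • u = (k • c).out • u := by
  rw [smul_smul, ← out_smul_eq hu (k * c.out)]
  congr 2
  conv_rhs => rw [← QuotientGroup.out_eq' c]
  rfl

theorem smul_sum_out_smul [Fintype (K ⧸ H)] (hu : ∀ h ∈ H, h • u = u) (k : K) :
    k • ∑ c : K ⧸ H, c.out • u = ∑ c : K ⧸ H, c.out • u := by
  rw [Finset.smul_sum]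
  simp only [smul_out_smul hu]
  exact Equiv.sum_comp (MulAction.toPerm k) fun c : K ⧸ H => c.out • u

end Trace

/-! ### Transfer and fusion -/

namespace HomogeneousCochain

variable {G V : Type*} [Group G] [AddCommGroup V] {n : ℕ}

/-- Corestriction after restriction is multiplication by the index: the trace over `K/H` of a
primitive of `z` has coboundary `∑ c • z`, and each `c • z = z`. -/
theorem relIndex_smul_mem_coboundaries [Finite G] {H K : Subgroup G}
    {z : HomogeneousCochain G V (n + 1)} (hz : z ∈ invariants V K (n + 1))
    (hzH : z ∈ coboundaries V H n) : H.relIndex K • z ∈ coboundaries V K n := by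
  classical
  obtain ⟨u, hu, rfl⟩ := hzH
  have : Fintype (K ⧸ H.subgroupOf K) := Fintype.ofFinite _
  have hu' : ∀ h ∈ H.subgroupOf K, h • u = u := fun h hh => hu _ hh
  refine ⟨∑ c : K ⧸ H.subgroupOf K, c.out • u, fun k hk => smul_sum_out_smul hu' ⟨k, hk⟩, ?_⟩
  rw [map_sum, Subgroup.relIndex, Subgroup.index, Nat.card_eq_fintype_card, ← Finset.card_univ,
    ← Finset.sum_const]
  exact Finset.sum_congr rfl fun c _ => hz _ c.out.2

theorem mem_coboundaries_of_coprime [Finite G] {H K : Subgroup G} {q : ℕ}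
    (hq : q.Coprime (H.relIndex K)) {z : HomogeneousCochain G V (n + 1)}
    (hz : z ∈ invariants V K (n + 1)) (hqz : q • z ∈ coboundaries V K n)
    (hzH : z ∈ coboundaries V H n) : z ∈ coboundaries V K n := by
  have h1 := relIndex_smul_mem_coboundaries hz hzH
  have h2 : ((q : ℤ) * q.gcdA (H.relIndex K) + (H.relIndex K : ℤ) * q.gcdB (H.relIndex K)) • z =
      z := by
    rw [← Nat.gcd_eq_gcd_ab, hq.gcd_eq_one, Nat.cast_one, one_smul]
  rw [← h2, add_smul, mul_comm, mul_smul, mul_comm, mul_smul, natCast_zsmul, natCast_zsmul]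
  exact add_mem (zsmul_mem hqz _) (zsmul_mem h1 _)

/-- Translation by `c⁻¹` commutes with translations by `A`, so the prism homotopy joins it to the
identity. -/
theorem smul_sub_mem_coboundaries_of_centralizes {A : Subgroup G} {c : G}
    (hc : c ∈ Subgroup.centralizer (A : Set G)) {f : HomogeneousCochain G V (n + 1)}
    (hf : f ∈ cocycles V A n) : c • f - f ∈ coboundaries V A n := by
  refine comap_sub_comap_mem_coboundaries (α := id) (β := (c⁻¹ * ·)) (fun _ _ _ => rfl)
    (fun a ha x => ?_) hf
  have := Subgroup.mem_centralizer_iff.1 (inv_mem hc) a ha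
  simp only [← mul_assoc, this]

/-- If `N` strongly controls fusion in `P`, the restriction to `P` of the transfer of the
restriction to `P` of an `N`-invariant cocycle is a multiple of that cocycle. -/
theorem sum_smul_sub_index_smul_mem_coboundaries [Finite G] {N P : Subgroup G} (hPN : P ≤ N)
    [Fintype (G ⧸ P)]
    (hN : StronglyControlsFusionIn N P) {f : HomogeneousCochain G V (n + 1)}
    (hf : f ∈ cocycles V N n) :
    ∑ c : G ⧸ P, c.out • f - P.index • f ∈ coboundaries V P n := by
  have hfP : ∀ h ∈ P, h • f = f := fun h hh => hf.1 h (hPN hh)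
  -- Equivariance makes the sum of the primitives `P`-invariant; this plays the role of the Mackey
  -- double coset formula.
  have key : ∃ u : G ⧸ P → HomogeneousCochain G V n, (∀ c, coboundary (u c) = c.out • f - f) ∧
      ∀ (p : P) c, u (p • c) = p • u c := by
    refine exists_equivariant_choice
      (fun (c : G ⧸ P) (b : HomogeneousCochain G V n) => coboundary b = c.out • f - f) ?_
      fun c => ?_
    · intro p c b hb
      have h1 : (p • c).out • f = p • c.out • f := (smul_out_smul hfP (p : G) c).symm
      rw [h1]
      refine (congrArg ((p : G) • ·) hb).trans ?_
      simp only [smul_sub, hfP p p.2]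
      rfl
    · obtain ⟨g, rfl⟩ := QuotientGroup.mk_surjective c
      -- The stabilizer of the coset `gP` in `P`.
      let A : Subgroup G := P ⊓ P.comap (MulAut.conj g⁻¹).toMonoidHom
      have hA : ∀ a, a ∈ A ↔ a ∈ P ∧ g⁻¹ * a * g ∈ P := fun a => by
        simp [A, Subgroup.mem_inf]
      obtain ⟨c, hc, h, hh, rfl⟩ := hN A g (fun a ha => ((hA a).1 ha).1) fun a ha =>
        ((hA a).1 ha).2
      obtain ⟨u, hu, hu'⟩ := smul_sub_mem_coboundaries_of_centralizes hc
        (cocycles_anti (fun a ha => hPN ((hA a).1 ha).1) hf)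
      refine ⟨u, ?_, fun p hp => hu p ((hA p).2 ⟨p.2, ?_⟩)⟩
      · rw [hu', out_smul_eq hfP, mul_smul, hf.1 h hh]
      · have hp' : (((p : G) * (c * h) : G) : G ⧸ P) = ((c * h : G) : G ⧸ P) := hp
        rw [mul_assoc]
        exact QuotientGroup.eq.1 hp'.symm
  obtain ⟨u, hu, hequiv⟩ := key
  refine ⟨∑ c, u c, fun p hp => ?_, ?_⟩
  · rw [Finset.smul_sum]
    have : ∀ c, p • u c = u (p • c) := fun c => (hequiv ⟨p, hp⟩ c).symm
    simp only [this]
    exact Equiv.sum_comp (MulAction.toPerm p) u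
  · rw [map_sum, Finset.sum_congr rfl fun c _ => hu c, Finset.sum_sub_distrib, Finset.sum_const,
      Finset.card_univ, ← Nat.card_eq_fintype_card, Subgroup.index]

variable {p : ℕ} [Fact p.Prime] [Finite G]

theorem mem_coboundaries_of_le_sylow (P : Sylow p G) {N : Subgroup G}
    {z : HomogeneousCochain G V (n + 1)} (hz : z ∈ cocycles V N n)
    {a : ℕ} (ha : p ^ a • z ∈ coboundaries V N n) (hPN : (P : Subgroup G) ≤ N)
    (hzP : z ∈ coboundaries V (P : Subgroup G) n) : z ∈ coboundaries V N n := by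
  refine mem_coboundaries_of_coprime ?_ hz.1 ha hzP
  refine Nat.Coprime.pow_left a ((Nat.Prime.coprime_iff_not_dvd Fact.out).2 fun hd => ?_)
  exact P.not_dvd_index (hd.trans (Subgroup.relIndex_dvd_index_of_le hPN))

theorem exists_cocycle_extension (P : Sylow p G) {N : Subgroup G} (hPN : (P : Subgroup G) ≤ N)
    (hN : StronglyControlsFusionIn N (P : Subgroup G)) {f : HomogeneousCochain G V (n + 1)}
    (hf : f ∈ cocycles V N n) {a : ℕ} (ha : p ^ a • f ∈ coboundaries V N n)
    (hab : ∀ A ≤ N, (∀ x ∈ A, ∀ y ∈ A, x * y = y * x) → f ∈ coboundaries V A n) :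
    ∃ y ∈ cocycles V (⊤ : Subgroup G) n, y - f ∈ coboundaries V N n ∧
      p ^ a • y ∈ coboundaries V ⊤ n ∧
      ∀ A : Subgroup G, (∀ x ∈ A, ∀ y ∈ A, x * y = y * x) → y ∈ coboundaries V A n := by
  classical
  have : Fintype (G ⧸ (P : Subgroup G)) := Fintype.ofFinite _
  have hfP : ∀ h ∈ (P : Subgroup G), h • f = f := fun h hh => hf.1 h (hPN hh)
  set w := ∑ c : G ⧸ (P : Subgroup G), c.out • f with hw
  have hwP := sum_smul_sub_index_smul_mem_coboundaries hPN hN hf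
  have hwZ : w ∈ cocycles V (⊤ : Subgroup G) n := by
    refine ⟨fun g _ => smul_sum_out_smul hfP g, ?_⟩
    change coboundary w = 0
    rw [hw, map_sum]
    exact Finset.sum_eq_zero fun c _ => by rw [coboundary_smul, hf.2, smul_zero]
  have hwa : p ^ a • w ∈ coboundaries V (⊤ : Subgroup G) n := by
    obtain ⟨u, hu, hu'⟩ := coboundaries_anti hPN ha
    refine ⟨∑ c : G ⧸ (P : Subgroup G), c.out • u, fun g _ => smul_sum_out_smul hu g, ?_⟩
    rw [map_sum, hw, Finset.smul_sum]
    exact Finset.sum_congr rfl fun c _ => by rw [coboundary_smul, hu', smul_comm]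
  have hcop : IsCoprime ((p ^ a : ℕ) : ℤ) ((P : Subgroup G).index : ℤ) :=
    Nat.isCoprime_iff_coprime.2 (Nat.Coprime.pow_left a
      ((Nat.Prime.coprime_iff_not_dvd Fact.out).2 P.not_dvd_index))
  obtain ⟨s, t, hst⟩ := hcop
  have hyZ : t • w ∈ cocycles V (⊤ : Subgroup G) n := zsmul_mem hwZ t
  have hya : p ^ a • t • w ∈ coboundaries V (⊤ : Subgroup G) n := by
    rw [smul_comm]
    exact zsmul_mem hwa t
  have hyN : t • w - f ∈ coboundaries V N n := by
    refine mem_coboundaries_of_le_sylow P (a := a)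
      (sub_mem (cocycles_anti le_top hyZ) hf) ?_ hPN ?_
    · rw [smul_sub]
      exact sub_mem (coboundaries_anti le_top hya) ha
    -- Substitute `f = s p^a f + t [G : P] f`; both resulting terms are coboundaries over `P`.
    · have h1 : t • w - f = t • (w - (P : Subgroup G).index • f) - s • (p ^ a • f) := by
        conv_lhs => rw [← one_smul ℤ f, ← hst]
        rw [smul_sub, add_smul, mul_smul, mul_smul, natCast_zsmul, natCast_zsmul]
        abel
      rw [h1]
      exact sub_mem (zsmul_mem hwP t) (zsmul_mem (coboundaries_anti hPN ha) s)
  refine ⟨t • w, hyZ, hyN, hya, fun A hA => ?_⟩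
  -- The class is killed by `p ^ a`, so its vanishing on `A` can be tested on a Sylow `p`-subgroup
  -- of `A`.
  obtain ⟨Q⟩ : Nonempty (Sylow p A) := inferInstance
  set Q' : Subgroup G := (Q : Subgroup A).map A.subtype with hQ'
  have hQA : Q' ≤ A := Subgroup.map_subtype_le _
  have hQp : IsPGroup p Q' := Q.isPGroup'.map _
  obtain ⟨R, hR⟩ := hQp.exists_le_sylow
  obtain ⟨g, hg⟩ := MulAction.exists_smul_eq G R P
  have hconj : ∀ x ∈ Q', g * x * g⁻¹ ∈ (P : Subgroup G) := fun x hx => by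
    rw [← hg, Sylow.coe_subgroup_smul]
    exact ⟨x, hR hx, by simp [MulAut.conj_apply]⟩
  have hmem : t • w ∈ coboundaries V (Q'.map (MulAut.conj g).toMonoidHom) n := by
    have hle : Q'.map (MulAut.conj g).toMonoidHom ≤ N := by
      rintro _ ⟨x, hx, rfl⟩
      exact hPN (hconj x hx)
    have h1 : t • w = (t • w - f) + f := by abel
    rw [h1]
    refine add_mem (coboundaries_anti hle hyN) (hab _ hle ?_)
    rintro _ ⟨x, hx, rfl⟩ _ ⟨y, hy, rfl⟩
    rw [← map_mul, ← map_mul, hA x (hQA hx) y (hQA hy)]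
  have hmem' : t • w ∈ coboundaries V Q' n := by
    -- `t • w` is `G`-invariant, so conjugating back to `Q'` does not change it.
    rw [← hyZ.1 g⁻¹ trivial]
    exact smul_mem_coboundaries _ (fun x hx =>
      Subgroup.mem_map.2 ⟨x, hx, by simp [MulAut.conj_apply]⟩) hmem
  refine mem_coboundaries_of_coprime (q := p ^ a) ?_ (cocycles_anti le_top hyZ).1
    (coboundaries_anti le_top hya) hmem'
  refine Nat.Coprime.pow_left a ((Nat.Prime.coprime_iff_not_dvd Fact.out).2 ?_)
  have : Q'.subgroupOf A = Q := Subgroup.comap_map_eq_self_of_injective A.subtype_injective _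
  rw [Subgroup.relIndex, this]
  exact Q.not_dvd_index

end HomogeneousCochain

/-! ### Comparison with inhomogeneous cochains -/

/-- An injective homomorphism `ι : H → G` admits an `H`-equivariant retraction `G → H`. -/
theorem MonoidHom.exists_equivariant_retraction {H G : Type*} [Group H] [Group G] {ι : H →* G}
    (hι : Function.Injective ι) :
    ∃ r : G → H, (∀ h, r (ι h) = h) ∧ ∀ h x, r (ι h * x) = h * r x := by
  let : MulAction H G := MulAction.compHom G ι
  -- The relation prescribes the value on the image of `ι` and nothing elsewhere; as `H` acts
  -- freely, stabilizers impose no condition.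
  obtain ⟨r, hr, hr'⟩ := exists_equivariant_choice (P := H) (X := G) (B := H)
    (fun x b => ∀ h, x = ι h → b = h)
    (fun p x b hb h hx => by
      have hx' : ι p * x = ι h := hx
      rw [hb (p⁻¹ * h) (by rw [map_mul, map_inv, ← hx', inv_mul_cancel_left])]
      exact mul_inv_cancel_left p h)
    (fun x => by
      have hfree : ∀ p : H, p • x = x → p = 1 := fun p hp => by
        have hp' : ι p * x = x := hp
        exact hι (by rw [map_one]; exact mul_eq_right.1 hp')
      by_cases hx : ∃ h, ι h = x
      · obtain ⟨h, rfl⟩ := hx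
        exact ⟨h, fun h' hh => hι hh, fun p hp => by rw [hfree p hp, one_smul]⟩
      · exact ⟨1, fun h hh => (hx ⟨h, hh.symm⟩).elim, fun p hp => by rw [hfree p hp, one_smul]⟩)
  exact ⟨r, fun h => hr _ h rfl, hr'⟩

theorem Fin.map_partialProd {H G : Type*} [Group H] [Group G] (ι : H →* G) {n : ℕ}
    (g : Fin n → H) (i : Fin (n + 1)) : ι (partialProd g i) = partialProd (ι ∘ g) i := by
  induction i using Fin.induction with
  | zero => simp
  | succ i ih => rw [partialProd_succ, partialProd_succ, map_mul, ih]; rfl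

namespace HomogeneousCochain

section Inhomogeneous

variable {H G V : Type*} [Group H] [Group G] [AddCommGroup V] {n : ℕ}

/-- The inhomogeneous cochain on `H` attached to a homogeneous cochain on `G` and a homomorphism
`ι : H → G`. -/
def toInhomogeneous (ι : H →* G) : HomogeneousCochain G V (n + 1) →+ ((Fin n → H) → V) where
  toFun f := fun g => f fun i => ι (Fin.partialProd g i)
  map_zero' := rfl
  map_add' _ _ := rfl

theorem toInhomogeneous_apply (ι : H →* G) (f : HomogeneousCochain G V (n + 1)) (g : Fin n → H) :
    toInhomogeneous ι f g = f fun i => ι (Fin.partialProd g i) := rfl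

theorem toInhomogeneous_comp {K : Type*} [Group K] (ι : H →* G) (κ : K →* H)
    (f : HomogeneousCochain G V (n + 1)) (g : Fin n → K) :
    toInhomogeneous ι f (κ ∘ g) = toInhomogeneous (ι.comp κ) f g := by
  simp only [toInhomogeneous_apply, ← Fin.map_partialProd, MonoidHom.comp_apply]

theorem toInhomogeneous_coboundary_apply {ι : H →* G} {f : HomogeneousCochain G V (n + 1)}
    (hf : f ∈ invariants V ι.range (n + 1)) (g : Fin (n + 1) → H) :
    toInhomogeneous ι (coboundary f) g = toInhomogeneous ι f (fun i => g i.succ) +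
      ∑ j : Fin (n + 1), (-1 : ℤ) ^ ((j : ℕ) + 1) •
        toInhomogeneous ι f (Fin.contractNth j (· * ·) g) := by
  rw [toInhomogeneous_apply, coboundary_apply, Fin.sum_univ_succ]
  congr 1
  · rw [Fin.val_zero, pow_zero, one_smul, toInhomogeneous_apply]
    refine Eq.trans ?_ (invariants_apply hf (h := ι (g 0)) ⟨g 0, rfl⟩ _)
    congr 1
    funext i
    simp only [Function.comp_apply, Fin.zero_succAbove, Fin.partialProd_succ', map_mul]
    rfl
  · refine Finset.sum_congr rfl fun j _ => ?_
    rw [toInhomogeneous_apply, Fin.partialProd_contractNth, Fin.val_succ]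
    rfl

theorem apply_eq_toInhomogeneous {ι : H →* G} {f : HomogeneousCochain G V (n + 1)}
    (hf : f ∈ invariants V ι.range (n + 1)) (y : Fin (n + 1) → H) :
    f (fun i => ι (y i)) = toInhomogeneous ι f fun i => (y i.castSucc)⁻¹ * y i.succ := by
  rw [toInhomogeneous_apply]
  refine Eq.trans ?_ (invariants_apply hf (h := ι (y 0)) ⟨y 0, rfl⟩ _)
  congr 1
  funext i
  rw [← map_mul]
  exact congrArg ι (congrFun (Fin.partialProd_left_inv y) i).symm

/-- Retract a tuple to `H` and apply `c` to its successive quotients. The last conclusion lets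
identities for `f` be checked on tuples from `H`. -/
theorem exists_toInhomogeneous_eq {ι : H →* G} {r : G → H} (hr : ∀ h, r (ι h) = h)
    (hr' : ∀ h x, r (ι h * x) = h * r x) (c : (Fin n → H) → V) :
    ∃ f ∈ invariants V ι.range (n + 1), toInhomogeneous ι f = c ∧
      comap (fun x => ι (r x)) f = f := by
  refine ⟨fun x => c fun i => (r (x i.castSucc))⁻¹ * r (x i.succ), ?_, ?_, ?_⟩
  · rintro _ ⟨h, rfl⟩
    funext x
    rw [smul_apply]
    simp only [← map_inv, hr']
    congr 1
    funext i
    group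
  · funext g
    rw [toInhomogeneous_apply]
    simp only [hr]
    congr 1
    funext i
    exact Fin.partialProd_right_inv g i
  · funext x
    rw [comap_apply]
    simp only [Function.comp_apply, hr]

theorem comap_eq_zero {ι : H →* G} (r : G → H) {f : HomogeneousCochain G V (n + 1)}
    (hf : f ∈ invariants V ι.range (n + 1)) (h0 : toInhomogeneous ι f = 0) :
    comap (fun x => ι (r x)) f = 0 := by
  funext x
  rw [comap_apply]
  exact (apply_eq_toInhomogeneous hf (fun i => r (x i))).trans (by rw [h0]; rfl)

theorem exists_cocycle_toInhomogeneous_eq {ι : H →* G} (hι : Function.Injective ι)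
    {c : (Fin n → H) → V}
    (hc : ∀ f ∈ invariants V ι.range (n + 1), toInhomogeneous ι f = c →
      toInhomogeneous ι (coboundary f) = 0) :
    ∃ f ∈ cocycles V ι.range n, toInhomogeneous ι f = c := by
  obtain ⟨r, hr, hr'⟩ := MonoidHom.exists_equivariant_retraction hι
  obtain ⟨f, hf, hfc, hrf⟩ := exists_toInhomogeneous_eq hr hr' c
  refine ⟨f, ⟨hf, ?_⟩, hfc⟩
  change coboundary f = 0
  rw [← hrf, coboundary_comap]
  exact comap_eq_zero r (fun h hh => by rw [← coboundary_smul, hf h hh]) (hc f hf hfc)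

/-- Lift `c` to `u`. The cocycle `f - coboundary u` vanishes on tuples from `H`, hence after
pullback along `ι ∘ r`, and that pullback is homotopic to the identity. -/
theorem mem_coboundaries_of_toInhomogeneous_eq {ι : H →* G} (hι : Function.Injective ι)
    {f : HomogeneousCochain G V (n + 2)} (hf : f ∈ cocycles V ι.range (n + 1))
    {c : (Fin n → H) → V}
    (hc : ∀ u ∈ invariants V ι.range (n + 1), toInhomogeneous ι u = c →
      toInhomogeneous ι (coboundary u) = toInhomogeneous ι f) :
    f ∈ coboundaries V ι.range (n + 1) := by
  obtain ⟨r, hr, hr'⟩ := MonoidHom.exists_equivariant_retraction hι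
  obtain ⟨u, hu, huc, -⟩ := exists_toInhomogeneous_eq hr hr' c
  have hDu : coboundary u ∈ coboundaries V ι.range (n + 1) := ⟨u, hu, rfl⟩
  have hz := sub_mem hf (coboundaries_le_cocycles _ hDu)
  have h0 : comap (fun x => ι (r x)) (f - coboundary u) = 0 :=
    comap_eq_zero r hz.1 (by rw [map_sub, hc u hu huc, sub_self])
  have h1 := comap_sub_comap_mem_coboundaries (α := fun x => ι (r x)) (β := id)
    (by rintro _ ⟨h, rfl⟩ x; rw [hr', map_mul]) (fun _ _ _ => rfl) hz
  rw [h0, sub_zero] at h1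
  have h2 := add_mem h1 hDu
  rwa [show comap id (f - coboundary u) = f - coboundary u from rfl, sub_add_cancel] at h2

end Inhomogeneous

section Cohomology

variable {k H G : Type u} [CommRing k] [Group H] [Group G] (ι : H →* G) (A : Rep.{u} k H)
  [A.IsTrivial] {n : ℕ}

theorem d_toInhomogeneous {f : HomogeneousCochain G A (n + 1)}
    (hf : f ∈ invariants A ι.range (n + 1)) :
    inhomogeneousCochains.d A n (toInhomogeneous ι f) = toInhomogeneous ι (coboundary f) := by
  funext g
  rw [toInhomogeneous_coboundary_apply hf, _root_.inhomogeneousCochains.d_hom_apply]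
  congr 1
  · exact Representation.isTrivial_apply A.ρ _ _
  · refine Finset.sum_congr rfl fun j _ => ?_
    rcases neg_one_pow_eq_or ℤ ((j : ℕ) + 1) with h | h
    · have h' : (-1 : k) ^ ((j : ℕ) + 1) = 1 := by exact_mod_cast congrArg (Int.cast : ℤ → k) h
      rw [h, h', one_smul, one_smul]
    · have h' : (-1 : k) ^ ((j : ℕ) + 1) = -1 := by exact_mod_cast congrArg (Int.cast : ℤ → k) h
      rw [h, h', neg_smul, neg_smul, one_smul, one_smul]

theorem d_toInhomogeneous_of_mem_cocycles {f : HomogeneousCochain G A (n + 1)}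
    (hf : f ∈ cocycles A ι.range n) :
    inhomogeneousCochains.d A n (toInhomogeneous ι f) = 0 := by
  rw [d_toInhomogeneous ι A hf.1, hf.2, map_zero]

end Cohomology

end HomogeneousCochain

/-! ### Classes of homogeneous cocycles in group cohomology -/

namespace groupCohomology

open CategoryTheory HomogeneousCochain

variable {k H G : Type u} [CommRing k] [Group H] [Group G]

theorem iCocycles_injective (A : Rep.{u} k H) (n : ℕ) :
    Function.Injective (iCocycles A n) :=
  (ModuleCat.mono_iff_injective _).1 inferInstance

theorem iCocycles_toCocycles (A : Rep.{u} k H) {n : ℕ} (c : (Fin n → H) → A) :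
    iCocycles A (n + 1) (toCocycles A n (n + 1) c) = _root_.inhomogeneousCochains.d A n c := by
  have h := (inhomogeneousCochains A).toCycles_i n (n + 1)
  rw [inhomogeneousCochains.d_def] at h
  exact ConcreteCategory.congr_hom h c

theorem π_eq_zero_iff (A : Rep.{u} k H) {n : ℕ} (x : groupCohomology.cocycles A (n + 1)) :
    π A (n + 1) x = 0 ↔
      ∃ c : (Fin n → H) → A, _root_.inhomogeneousCochains.d A n c = iCocycles A (n + 1) x := by
  have hex : (ShortComplex.mk (toCocycles A n (n + 1)) (π A (n + 1))
      ((inhomogeneousCochains A).toCycles_comp_homologyπ n (n + 1))).Exact :=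
    ShortComplex.exact_of_g_is_cokernel _
      ((inhomogeneousCochains A).homologyIsCokernel n (n + 1) (by simp))
  constructor
  · intro h
    obtain ⟨c, rfl⟩ := (ShortComplex.moduleCat_exact_iff _).1 hex x h
    exact ⟨c, (iCocycles_toCocycles A c).symm⟩
  · rintro ⟨c, hc⟩
    rw [← iCocycles_toCocycles] at hc
    rw [← iCocycles_injective A _ hc]
    exact ConcreteCategory.congr_hom
      ((inhomogeneousCochains A).toCycles_comp_homologyπ n (n + 1)) c

/-- The class of an invariant homogeneous cocycle on `G` in the cohomology of `H`. -/
noncomputable def ofHomogeneous (ι : H →* G) (A : Rep.{u} k H) [A.IsTrivial] (n : ℕ) :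
    HomogeneousCochain.cocycles A ι.range n →+ groupCohomology A n :=
  AddMonoidHom.mk' (fun f => π A n (cocyclesMk (toInhomogeneous ι f.1)
    (d_toInhomogeneous_of_mem_cocycles ι A f.2))) fun f g => by
    rw [← map_add]
    congr 1
    apply iCocycles_injective
    rw [map_add, iCocycles_mk, iCocycles_mk, iCocycles_mk]
    rfl

variable {ι : H →* G} {A : Rep.{u} k H} [A.IsTrivial] {n : ℕ}

theorem ofHomogeneous_surjective (hι : Function.Injective ι) :
    Function.Surjective (ofHomogeneous ι A n) := by
  intro x
  induction x using groupCohomology_induction_on with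
  | h x =>
    have hx : _root_.inhomogeneousCochains.d A n (iCocycles A n x) = 0 := by
      have h := (inhomogeneousCochains A).iCycles_d n (n + 1)
      rw [inhomogeneousCochains.d_def] at h
      exact ConcreteCategory.congr_hom h x
    obtain ⟨f, hf, hfx⟩ := exists_cocycle_toInhomogeneous_eq (V := A) hι
      (c := iCocycles A n x) fun f hf hfx => by rw [← d_toInhomogeneous ι A hf, hfx, hx]
    refine ⟨⟨f, hf⟩, congrArg (π A n) (iCocycles_injective A n ?_)⟩
    rw [iCocycles_mk, hfx]

/-- Positive degree matters: because of the augmentation, constants are coboundaries in degree `0`,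
although they represent nonzero classes of `H^0`. -/
theorem ofHomogeneous_eq_zero_iff (hι : Function.Injective ι)
    (f : HomogeneousCochain.cocycles A ι.range (n + 1)) :
    ofHomogeneous ι A (n + 1) f = 0 ↔ f.1 ∈ coboundaries A ι.range (n + 1) := by
  change π A (n + 1) _ = 0 ↔ _
  rw [π_eq_zero_iff, iCocycles_mk]
  constructor
  · rintro ⟨c, hc⟩
    exact mem_coboundaries_of_toInhomogeneous_eq hι f.2 (c := c) fun u hu huc => by
      rw [← d_toInhomogeneous ι A hu, huc, hc]
  · rintro ⟨u, hu, huf⟩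
    exact ⟨toInhomogeneous ι u, by rw [d_toInhomogeneous ι A hu, huf]⟩

theorem map_ofHomogeneous {K : Type u} [Group K] (κ : K →* H) [(Rep.res κ A).IsTrivial]
    (f : HomogeneousCochain.cocycles A ι.range n)
    (hf : f.1 ∈ HomogeneousCochain.cocycles A (ι.comp κ).range n) :
    groupCohomology.map κ (𝟙 (Rep.res κ A)) n (ofHomogeneous ι A n f) =
      ofHomogeneous (ι.comp κ) (Rep.res κ A) n ⟨f.1, hf⟩ := by
  refine (π_map_apply _ _ _ _).trans (congrArg (π _ n) (iCocycles_injective _ n ?_))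
  rw [iCocycles_mk]
  have h := HomologicalComplex.cyclesMap_i (cochainsMap κ (𝟙 (Rep.res κ A))) n
  refine (ConcreteCategory.congr_hom h _).trans ?_
  refine (congrArg ((cochainsMap κ (𝟙 (Rep.res κ A))).f n) (iCocycles_mk _ _)).trans ?_
  funext g
  exact toInhomogeneous_comp ι κ f.1 g

end groupCohomology

/-! ### Sylow subgroups of abelian groups as primary torsion -/

section SylowOfCommGroup

variable {p : ℕ}

/-- By commutativity, the join of `S` with a cyclic `p`-subgroup is a `p`-group, so maximality of
`S` absorbs it. -/
theorem Sylow.mem_iff_of_comm {C : Type*} [CommGroup C] (S : Sylow p C) {x : C} :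
    x ∈ S ↔ ∃ a, x ^ p ^ a = 1 := by
  constructor
  · intro hx
    obtain ⟨a, ha⟩ := S.isPGroup' ⟨x, hx⟩
    exact ⟨a, congrArg Subtype.val ha⟩
  · rintro ⟨a, ha⟩
    have hz : IsPGroup p (Subgroup.zpowers x) := by
      rintro ⟨_, m, rfl⟩
      refine ⟨a, Subtype.ext ?_⟩
      change (x ^ m) ^ p ^ a = 1
      rw [← zpow_natCast, zpow_comm, zpow_natCast, ha, one_zpow]
    have h := S.is_maximal' (S.isPGroup'.to_sup_of_normal_right hz) le_sup_left
    have hx : x ∈ (S : Subgroup C) ⊔ Subgroup.zpowers x :=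
      Subgroup.mem_sup_right (Subgroup.mem_zpowers x)
    rwa [h] at hx

/-- A homomorphism of abelian groups that is bijective on `p`-primary torsion induces an
isomorphism of Sylow `p`-subgroups. -/
theorem Sylow.nonempty_mulEquiv_of_primary {C D : Type*} [AddCommGroup C] [AddCommGroup D]
    (φ : C →+ D) (hinj : ∀ x a, p ^ a • x = 0 → φ x = 0 → x = 0)
    (hsurj : ∀ y a, p ^ a • y = 0 → ∃ x, p ^ a • x = 0 ∧ φ x = y)
    (S : Sylow p (Multiplicative C)) (T : Sylow p (Multiplicative D)) : Nonempty (S ≃* T) := by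
  have hS : ∀ x : C, Multiplicative.ofAdd x ∈ S ↔ ∃ a, p ^ a • x = 0 := fun x =>
    S.mem_iff_of_comm
  have hT : ∀ x : D, Multiplicative.ofAdd x ∈ T ↔ ∃ a, p ^ a • x = 0 := fun x =>
    T.mem_iff_of_comm
  let ψ : S →* T := ((AddMonoidHom.toMultiplicative φ).comp (S : Subgroup _).subtype).codRestrict
    (T : Subgroup _) fun x => by
      obtain ⟨a, ha⟩ := (hS x.1.toAdd).1 x.2
      exact (hT (φ x.1.toAdd)).2 ⟨a, by rw [← map_nsmul, ha, map_zero]⟩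
  refine ⟨MulEquiv.ofBijective ψ ⟨(injective_iff_map_eq_one ψ).2 fun x hx => ?_, fun y => ?_⟩⟩
  · obtain ⟨a, ha⟩ := (hS x.1.toAdd).1 x.2
    exact Subtype.ext (hinj x.1.toAdd a ha (congrArg Subtype.val hx))
  · obtain ⟨a, ha⟩ := (hT y.1.toAdd).1 y.2
    obtain ⟨x, hx, hxy⟩ := hsurj _ a ha
    exact ⟨⟨Multiplicative.ofAdd x, (hS x).2 ⟨a, hx⟩⟩, Subtype.ext hxy⟩

end SylowOfCommGroup

/-! ### `Sha` through homogeneous cocycles -/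

section Sha

open CategoryTheory HomogeneousCochain groupCohomology

variable {k G H : Type u} [CommRing k] [Group G] [Group H]

theorem mem_Sha {M : Rep.{u} k G} {n : ℕ} {x : groupCohomology M n} :
    x ∈ Sha M n ↔ ∀ A : Subgroup G, (∀ x ∈ A, ∀ y ∈ A, x * y = y * x) →
      groupCohomology.map A.subtype (𝟙 (Rep.res A.subtype M)) n x = 0 := by
  simp only [Sha, Submodule.mem_iInf]
  rfl

/-- The trivial subgroup is abelian, and restriction to it is the inclusion of the invariants in
`M`. -/
theorem Sha_zero_eq_bot (M : Rep.{u} k G) : Sha M 0 = ⊥ := by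
  refine (Submodule.eq_bot_iff _).2 fun x hx => ?_
  have h1 := mem_Sha.1 hx ⊥ (by simp)
  have h2 := map_H0Iso_hom_f_apply (⊥ : Subgroup G).subtype
    (𝟙 (Rep.res (⊥ : Subgroup G).subtype M)) x
  rw [h1, map_zero, map_zero] at h2
  have h3 : (H0Iso M).hom x = 0 := Subtype.ext h2.symm
  exact (ModuleCat.mono_iff_injective (H0Iso M).hom).1 inferInstance (h3.trans (map_zero _).symm)

instance Rep.isTrivial_res (M : Rep.{u} k G) [M.IsTrivial] (κ : H →* G) :
    (Rep.res κ M).IsTrivial :=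
  ⟨fun h => M.ρ.isTrivial_def (κ h)⟩

/-- Restriction keeps the cochain and shrinks the group under which primitives must be invariant. -/
theorem ofHomogeneous_mem_Sha_iff {ι : H →* G} (hι : Function.Injective ι) {A : Rep.{u} k H}
    [A.IsTrivial] {n : ℕ} (f : HomogeneousCochain.cocycles A ι.range (n + 1)) :
    ofHomogeneous ι A (n + 1) f ∈ Sha A (n + 1) ↔
      ∀ B : Subgroup H, (∀ x ∈ B, ∀ y ∈ B, x * y = y * x) →
        f.1 ∈ coboundaries A (B.map ι) (n + 1) := by
  rw [mem_Sha]
  refine forall₂_congr fun B _ => ?_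
  have hr : (ι.comp B.subtype).range = B.map ι := by
    rw [MonoidHom.range_comp, Subgroup.range_subtype]
  have hle : (ι.comp B.subtype).range ≤ ι.range := by
    rw [hr]
    exact Subgroup.map_le_range ι B
  rw [map_ofHomogeneous B.subtype f (cocycles_anti hle f.2),
    ofHomogeneous_eq_zero_iff (ι := ι.comp B.subtype)
      (show Function.Injective (ι ∘ B.subtype) from hι.comp B.subtype_injective), ← hr]

theorem ofHomogeneous_id_mem_Sha_iff {M : Rep.{u} k G} [M.IsTrivial] {n : ℕ}
    (f : HomogeneousCochain.cocycles M (MonoidHom.id G).range (n + 1)) :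
    ofHomogeneous (MonoidHom.id G) M (n + 1) f ∈ Sha M (n + 1) ↔
      ∀ B : Subgroup G, (∀ x ∈ B, ∀ y ∈ B, x * y = y * x) → f.1 ∈ coboundaries M B (n + 1) := by
  rw [ofHomogeneous_mem_Sha_iff Function.injective_id]
  simp only [Subgroup.map_id]

theorem ofHomogeneous_subtype_mem_Sha_iff {M : Rep.{u} k G} [M.IsTrivial] {N : Subgroup G} {n : ℕ}
    (f : HomogeneousCochain.cocycles M N.subtype.range (n + 1)) :
    ofHomogeneous N.subtype (Rep.res N.subtype M) (n + 1) f ∈ Sha (Rep.res N.subtype M) (n + 1) ↔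
      ∀ B ≤ N, (∀ x ∈ B, ∀ y ∈ B, x * y = y * x) → f.1 ∈ coboundaries M B (n + 1) := by
  rw [ofHomogeneous_mem_Sha_iff N.subtype_injective]
  constructor
  · intro h B hB hab
    have := h (B.subgroupOf N) fun x hx y hy => Subtype.ext (hab _ hx _ hy)
    rwa [Subgroup.map_subgroupOf_eq_of_le hB] at this
  · intro h B hab
    refine h _ (Subgroup.map_subtype_le B) ?_
    rintro _ ⟨x, hx, rfl⟩ _ ⟨y, hy, rfl⟩
    rw [← map_mul, ← map_mul, hab x hx y hy]

theorem map_subtype_ofHomogeneous_id {M : Rep.{u} k G} [M.IsTrivial] {N : Subgroup G} {n : ℕ}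
    (f : HomogeneousCochain.cocycles M (MonoidHom.id G).range n)
    (hf : f.1 ∈ HomogeneousCochain.cocycles M N.subtype.range n) :
    groupCohomology.map N.subtype (𝟙 (Rep.res N.subtype M)) n
        (ofHomogeneous (MonoidHom.id G) M n f) =
      ofHomogeneous N.subtype (Rep.res N.subtype M) n ⟨f.1, hf⟩ :=
  map_ofHomogeneous N.subtype f hf

theorem map_subtype_mem_Sha {M : Rep.{u} k G} [M.IsTrivial] {N : Subgroup G} {n : ℕ}
    {x : groupCohomology M (n + 1)} (hx : x ∈ Sha M (n + 1)) :
    groupCohomology.map N.subtype (𝟙 (Rep.res N.subtype M)) (n + 1) x ∈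
      Sha (Rep.res N.subtype M) (n + 1) := by
  obtain ⟨f, rfl⟩ := ofHomogeneous_surjective (ι := MonoidHom.id G) Function.injective_id x
  have hf : f.1 ∈ HomogeneousCochain.cocycles M N.subtype.range (n + 1) :=
    cocycles_anti (fun x _ => MonoidHom.mem_range.2 ⟨x, rfl⟩) f.2
  rw [map_subtype_ofHomogeneous_id f hf, ofHomogeneous_subtype_mem_Sha_iff]
  exact fun B _ hab => (ofHomogeneous_id_mem_Sha_iff f).1 hx B hab

variable {p : ℕ} [Fact p.Prime] [Finite G]

theorem eq_zero_of_map_subtype_eq_zero (P : Sylow p G) {N : Subgroup G}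
    (hPN : (P : Subgroup G) ≤ N) {M : Rep.{u} k G} [M.IsTrivial] {n a : ℕ}
    {x : groupCohomology M (n + 1)} (ha : p ^ a • x = 0)
    (hx : groupCohomology.map N.subtype (𝟙 (Rep.res N.subtype M)) (n + 1) x = 0) : x = 0 := by
  obtain ⟨f, rfl⟩ := ofHomogeneous_surjective (ι := MonoidHom.id G) Function.injective_id x
  have hle : N.subtype.range ≤ (MonoidHom.id G).range := fun x _ => ⟨x, rfl⟩
  rw [map_subtype_ofHomogeneous_id f (cocycles_anti hle f.2),
    ofHomogeneous_eq_zero_iff N.subtype_injective] at hx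
  rw [← map_nsmul, ofHomogeneous_eq_zero_iff Function.injective_id] at ha
  rw [ofHomogeneous_eq_zero_iff Function.injective_id]
  refine mem_coboundaries_of_le_sylow P f.2 ha ?_ (coboundaries_anti ?_ hx)
  · exact fun x _ => ⟨x, rfl⟩
  · rwa [Subgroup.range_subtype]

theorem exists_mem_Sha_map_subtype_eq (P : Sylow p G) {N : Subgroup G}
    (hPN : (P : Subgroup G) ≤ N) (hN : StronglyControlsFusionIn N (P : Subgroup G))
    {M : Rep.{u} k G} [M.IsTrivial] {n a : ℕ}
    {x : groupCohomology (Rep.res N.subtype M) (n + 1)} (hx : x ∈ Sha (Rep.res N.subtype M) (n + 1))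
    (ha : p ^ a • x = 0) :
    ∃ y ∈ Sha M (n + 1), p ^ a • y = 0 ∧
      groupCohomology.map N.subtype (𝟙 (Rep.res N.subtype M)) (n + 1) y = x := by
  obtain ⟨f, rfl⟩ := ofHomogeneous_surjective N.subtype_injective x
  rw [← map_nsmul, ofHomogeneous_eq_zero_iff N.subtype_injective] at ha
  have hfN : f.1 ∈ HomogeneousCochain.cocycles M N (n + 1) :=
    cocycles_anti (Subgroup.range_subtype N).ge f.2
  obtain ⟨y, hyZ, hyN, hya, hyab⟩ := exists_cocycle_extension P hPN hN hfN (a := a)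
    (coboundaries_anti (Subgroup.range_subtype N).ge ha)
    ((ofHomogeneous_subtype_mem_Sha_iff f).1 hx)
  have hyZ' : y ∈ HomogeneousCochain.cocycles M (MonoidHom.id G).range (n + 1) :=
    cocycles_anti le_top hyZ
  refine ⟨ofHomogeneous (MonoidHom.id G) M (n + 1) ⟨y, hyZ'⟩,
    (ofHomogeneous_id_mem_Sha_iff _).2 hyab, ?_, ?_⟩
  · rw [← map_nsmul, ofHomogeneous_eq_zero_iff Function.injective_id]
    exact coboundaries_anti le_top hya
  · rw [map_subtype_ofHomogeneous_id _ (cocycles_anti le_top hyZ), ← sub_eq_zero, ← map_sub,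
      ofHomogeneous_eq_zero_iff N.subtype_injective]
    exact coboundaries_anti (Subgroup.range_subtype N).le hyN

end Sha

/-! ### The main theorem -/

theorem CharacteristicPFunctor.le_normalizer_onSylow {p : ℕ} {G : Type u} [Group G] [Finite G]
    (W : CharacteristicPFunctor.{u} p) (P : Sylow p G) :
    (P : Subgroup G) ≤ Subgroup.normalizer (W.onSylow P : Set G) := by
  have := W.obj_characteristic (P : Subgroup G) P.isPGroup'
  have h := Subgroup.le_normalizer_map (H := W.obj (P : Subgroup G) P.isPGroup')
    (P : Subgroup G).subtype
  rwa [Subgroup.normalizer_eq_top, ← MonoidHom.range_eq_map, Subgroup.range_subtype] at h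

theorem mainTheorem2 {p : ℕ} [Fact p.Prime] {k G : Type u} [CommRing k] [Group G] [Finite G]
    (P : Sylow p G) (M : Rep.{u} k G) [M.IsTrivial]
    (W : CharacteristicPFunctor.{u} p) (hW : W.StronglyControlsFusion G) (n : ℕ)
    (S : Sylow p (Multiplicative (Sha M n)))
    (T : Sylow p (Multiplicative
      (Sha (Rep.res (Subgroup.normalizer (W.onSylow P : Set G)).subtype M) n))) :
    Nonempty (S ≃* T) := by
  have hPN := W.le_normalizer_onSylow P
  have hN := hW P
  revert T hPN hN
  -- From here only `P ≤ N` and strong control of fusion by `N` are needed.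
  generalize Subgroup.normalizer (W.onSylow P : Set G) = N
  intro T hPN hN
  cases n with
  | zero =>
    -- In degree `0` both `Sha` groups are trivial, so the zero map serves.
    refine Sylow.nonempty_mulEquiv_of_primary 0 (fun x _ _ _ => ?_)
      (fun y _ _ => ⟨0, smul_zero _, ?_⟩) S T
    · exact Subtype.ext ((Submodule.mem_bot k).1 (Sha_zero_eq_bot M ▸ x.2))
    · exact (Subtype.ext ((Submodule.mem_bot k).1
        (Sha_zero_eq_bot (Rep.res N.subtype M) ▸ y.2))).symm
  | succ n =>
    let φ : Sha M (n + 1) →ₗ[k] Sha (Rep.res N.subtype M) (n + 1) :=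
      (groupCohomology.map N.subtype (CategoryTheory.CategoryStruct.id (Rep.res N.subtype M))
        (n + 1)).hom.restrict
        fun _ hx => map_subtype_mem_Sha hx
    refine Sylow.nonempty_mulEquiv_of_primary φ.toAddMonoidHom (fun x a ha hx => ?_)
      (fun y a ha => ?_) S T
    · exact Subtype.ext (eq_zero_of_map_subtype_eq_zero P hPN (congrArg Subtype.val ha)
        (congrArg Subtype.val hx))
    · obtain ⟨x, hx, hxa, hxy⟩ :=
        exists_mem_Sha_map_subtype_eq P hPN hN y.2 (congrArg Subtype.val ha)
      exact ⟨⟨x, hx⟩, Subtype.ext hxa, Subtype.ext hxy⟩
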